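/- Let $\Bbbk$ be a field; all algebras are unital associative $\Bbbk$-algebras and all homomorphisms, isomorphisms and automorphisms are $\Bbbk$-linear algebra maps. For an automorphism $\sigma$ of an algebra $A$, let $A[t;\sigma]$ denote the skew polynomial algebra of polynomials $\sum_i a_i t^i$ ($a_i\in A$) with multiplication determined by $ta=\sigma(a)t$ for $a\in A$. An iterated skew polynomial extension $A[t_1;\sigma_1]\cdots[t_n;\sigma_n]$ is obtained by repeating this construction $n$ times, where each $\sigma_i$ is an automorphism of $A[t_1;\sigma_1]\cdots[t_{i-1};\sigma_{i-1}]$. An algebra $A$ is called strongly $\sigma$-cancellative if, for every $n\ge 1$, every algebra $B$ and all iterated skew polynomial extensions in $n$ variables, an isomorphism $$A[s_1;\sigma_1]\cdots[s_n;\sigma_n]\cong B[t_1;\tau_1]\cdots[t_n;\tau_n]$$ implies $A\cong B$. Theorem 4.6. Let $A$ be a right (respectively, left) noetherian simple domain over $\Bbbk$ such that $A^\times=\Bbbk^\times$, that is, the units of $A$ are exactly the nonzero scalars. Then $A$ is strongly $\sigma$-cancellative. In particular, if $\Bbbk$ has characteristic zero, then the first Weyl algebra, i.e. the $\Bbbk$-algebra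 generated by $x,y$ subject to the relation $xy-yx=1$, is strongly $\sigma$-cancellative. -/

import Mathlib

universe u v w

noncomputable section

/-! ### Skew polynomial extensions `A[t; σ]` -/

/-- The action of `ℕ` on `A` in which `n` acts as `σ ^ n`. -/
@[reducible]
def skewAction {k : Type u} [Field k] {A : Type v} [Ring A] [Algebra k A] (σ : A ≃ₐ[k] A) :
    MulSemiringAction (Multiplicative ℕ) A :=
  MulSemiringAction.compHom A (powersHom (A ≃ₐ[k] A) σ)

/-- The skew polynomial extension `A[t; σ]` (that is, `A[t; σ, δ]` with `δ = 0`): the polynomials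
`∑ aᵢ tⁱ` with `aᵢ ∈ A`, multiplied according to `t a = σ(a) t`. -/
def SkewExt {k : Type u} [Field k] {A : Type v} [Ring A] [Algebra k A] (_σ : A ≃ₐ[k] A) :
    Type v :=
  SkewPolynomial A

namespace SkewExt

instance instRing {k : Type u} [Field k] {A : Type v} [Ring A] [Algebra k A] (σ : A ≃ₐ[k] A) :
    Ring (SkewExt σ) :=
  letI := skewAction σ
  show Ring (SkewPolynomial A) from inferInstance

instance instAlgebra {k : Type u} [Field k] {A : Type v} [Ring A] [Algebra k A] (σ : A ≃ₐ[k] A) :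
    Algebra k (SkewExt σ) :=
  letI := skewAction σ
  haveI : SMulCommClass (Multiplicative ℕ) k A :=
    ⟨fun n c a => map_smul (powersHom (A ≃ₐ[k] A) σ n) c a⟩
  show Algebra k (SkewPolynomial A) from inferInstance

/-- The inclusion of `A` in `A[t; σ]` as the constants. -/
def C {k : Type u} [Field k] {A : Type v} [Ring A] [Algebra k A] (σ : A ≃ₐ[k] A) :
    A →+* SkewExt σ :=
  letI := skewAction σ
  SkewPolynomial.CRingHom

/-- The variable `t` of `A[t; σ]`. -/
def t {k : Type u} [Field k] {A : Type v} [Ring A] [Algebra k A] (σ : A ≃ₐ[k] A) :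
    SkewExt σ :=
  SkewPolynomial.X (R := A)

theorem t_mul_C {k : Type u} [Field k] {A : Type v} [Ring A] [Algebra k A] (σ : A ≃ₐ[k] A)
    (a : A) : t σ * C σ a = C σ (σ a) * t σ := by
  let := skewAction σ
  have h : (SkewPolynomial.X * SkewPolynomial.CRingHom a : SkewPolynomial A)
      = SkewPolynomial.CRingHom (σ a) * SkewPolynomial.X := by
    rw [SkewPolynomial.CRingHom_eq_C, SkewPolynomial.CRingHom_eq_C,
      ← SkewPolynomial.monomial_zero_left, ← SkewPolynomial.monomial_zero_left,
      SkewPolynomial.X_mul_monomial, SkewPolynomial.monomial_mul_X]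
    congr 1
  exact h

end SkewExt

/-! ### Iterated skew polynomial extensions -/

/-- `SkewTower k A n` is the type of all choices of automorphisms
`σ₁, …, σₙ` defining an iterated skew polynomial extension `A[t₁; σ₁] ⋯ [tₙ; σₙ]`:
`σ₁` is a `k`-algebra automorphism of `A`, and `σ₂, …, σₙ` are the data of an iterated
skew polynomial extension of `A[t₁; σ₁]`. -/
inductive SkewTower (k : Type u) [Field k] :
    (A : Type v) → [Ring A] → [Algebra k A] → ℕ → Type (max u (v + 1))
  | nil {A : Type v} [Ring A] [Algebra k A] : SkewTower k A 0
  | cons {A : Type v} [Ring A] [Algebra k A] {n : ℕ} (σ : A ≃ₐ[k] A)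
      (T : SkewTower k (SkewExt σ) n) : SkewTower k A (n + 1)

/-- The `k`-algebra `A[t₁; σ₁] ⋯ [tₙ; σₙ]` defined by the automorphisms `σ₁, …, σₙ`. -/
def SkewTower.total {k : Type u} [Field k] :
    {A : Type v} → [Ring A] → [Algebra k A] → {n : ℕ} → SkewTower k A n → AlgCat.{v} k
  | A, _, _, _, @SkewTower.nil _ _ _ _ _ => AlgCat.of k A
  | _, _, _, _, @SkewTower.cons _ _ _ _ _ _ _ T => T.total

/-- `A` is strongly `σ`-cancellative: for every `n ≥ 1` and every `k`-algebra `B`, if some iterated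
skew polynomial extensions of `A` and of `B` in `n` variables are isomorphic as `k`-algebras, then
`A` and `B` are isomorphic as `k`-algebras. -/
def StronglySigmaCancellative (k : Type u) [Field k] (A : Type v) [Ring A] [Algebra k A] : Prop :=
  ∀ (B : Type w) [Ring B] [Algebra k B] (n : ℕ), 1 ≤ n →
    ∀ (S : SkewTower k A n) (T : SkewTower k B n),
      Nonempty (S.total ≃ₐ[k] T.total) → Nonempty (A ≃ₐ[k] B)

/-! ### The first Weyl algebra -/

/-- The defining relation `x y - y x = 1`, with `x`, `y` the free generators `0` and `1`. -/
inductive FirstWeylRel (k : Type u) [Field k] :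
    FreeAlgebra k (Fin 2) → FreeAlgebra k (Fin 2) → Prop
  | comm : FirstWeylRel k
      (FreeAlgebra.ι k 0 * FreeAlgebra.ι k 1 - FreeAlgebra.ι k 1 * FreeAlgebra.ι k 0) 1

/-- The first Weyl algebra: the `k`-algebra generated by `x`, `y` subject to `x y - y x = 1`. -/
def FirstWeylAlgebra (k : Type u) [Field k] : Type u :=
  RingQuot (FirstWeylRel k)

instance FirstWeylAlgebra.instRing (k : Type u) [Field k] : Ring (FirstWeylAlgebra k) :=
  inferInstanceAs (Ring (RingQuot (FirstWeylRel k)))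

instance FirstWeylAlgebra.instAlgebra (k : Type u) [Field k] : Algebra k (FirstWeylAlgebra k) :=
  inferInstanceAs (Algebra k (RingQuot (FirstWeylRel k)))

end

/-! The invariant is the deviation of the lattice of two-sided ideals, a form of Krull dimension in
which `DeviationLT 1` is the descending chain condition. Bounds on it shift by exactly one with each
skew variable. Upwards (`DeviationLT.orderHom`, `SkewExt.leadingIdeals_strictMono`): leading
coefficients send ideals of `A[t; σ]` strictly monotonically to increasing sequences of ideals of
`A`. Downwards (`SkewTower.deviationLT_of_total`): every layer of the filtration by order in `t`
contains a copy of the ideal lattice of `A`.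

Suppose extensions of a simple `A` and of `B` in `n` variables are isomorphic. Then `B` has the
descending chain condition on two-sided ideals. It also embeds in the extension of `A`, so it is a
domain with only scalar units. If `b ≠ 0` and `B b ⊆ b B`, the ideals `b ^ i B` stabilise, so `b` is
a unit and hence a scalar. Killing the variables over `B` gives a surjection from the extension of
`A` onto `B`. Each variable `t` over `A` satisfies `f t = t g`, so its image is a scalar; hence `A`
alone maps onto `B`, injectively by simplicity.

For the Weyl algebra, the commutator with `y` is a locally nilpotent derivation with kernel `k[y]`
in characteristic zero. Its nilpotency order behaves as a degree in `x`, which gives the domain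
property and the units; commutators with `y` and then `x` give simplicity. -/

open Filter

/-! ### Deviation of posets and of posets of monotone sequences -/

/-- `DeviationLT m a b`: the interval `[a, b]` has deviation less than `m`. For `m = 0` this says
that there is no proper inclusion `a < b`, and for `m = 1` that the interval satisfies the
descending chain condition. -/
def DeviationLT {P : Type*} [PartialOrder P] : ℕ → P → P → Prop
  | 0, a, b => ¬ a < b
  | m + 1, a, b => ∀ c : ℕ → P, Antitone c → (∀ i, a ≤ c i ∧ c i ≤ b) →
      ∀ᶠ i in atTop, DeviationLT m (c (i + 1)) (c i)

namespace DeviationLT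

/-- Deviation bounds are reflected by a monotone map together with a finite family of monotone
maps that jointly detect strict inequalities. -/
theorem of_jointly_strictMono {ι : Type*} [Finite ι] {P Q R : Type*} [PartialOrder P]
    [PartialOrder Q] [PartialOrder R] (f : ι → P → Q) (g : P → R) (hf : ∀ i, Monotone (f i))
    (hg : Monotone g) (hlt : ∀ x y, x < y → g x < g y ∨ ∃ i, f i x < f i y) {m : ℕ} {a b : P}
    (h : ∀ i, DeviationLT m (f i a) (f i b)) (h' : DeviationLT m (g a) (g b)) :
    DeviationLT m a b := by
  induction m generalizing a b with
  | zero =>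
    intro hab
    obtain hi | ⟨i, hi⟩ := hlt a b hab
    exacts [h' hi, h i hi]
  | succ m ih =>
    intro c hc hab
    have hF := eventually_all.2 fun i ↦ h i (f i ∘ c) ((hf i).comp_antitone hc)
      fun j ↦ ⟨hf i (hab j).1, hf i (hab j).2⟩
    have hG := h' (g ∘ c) (hg.comp_antitone hc) fun j ↦ ⟨hg (hab j).1, hg (hab j).2⟩
    exact (hF.and hG).mono fun j hj ↦ ih hj.1 hj.2

theorem of_strictMono {P Q : Type*} [PartialOrder P] [PartialOrder Q] {f : P → Q}
    (hf : StrictMono f) {m : ℕ} {a b : P} (h : DeviationLT m (f a) (f b)) :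
    DeviationLT m a b :=
  of_jointly_strictMono (fun (i : Empty) (_ : P) ↦ (i.elim : Q)) f (fun i ↦ i.elim) hf.monotone
    (fun _ _ h ↦ Or.inl (hf h)) (fun i ↦ i.elim) h

theorem mono {P : Type*} [PartialOrder P] {m : ℕ} {a b a' b' : P} (ha : a ≤ a') (hb : b' ≤ b)
    (h : DeviationLT m a b) : DeviationLT m a' b' := by
  cases m with
  | zero => exact fun hab ↦ h (ha.trans_lt (hab.trans_le hb))
  | succ m => exact fun c hc hab ↦ h c hc fun i ↦ ⟨ha.trans (hab i).1, (hab i).2.trans hb⟩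

end DeviationLT

/-- The tail of a monotone sequence. -/
def seqTail {L : Type*} [PartialOrder L] (N : ℕ) (w : ℕ →o L) : ℕ →o L :=
  ⟨fun j ↦ w (N + j), fun _ _ h ↦ w.monotone (by lia)⟩

theorem OrderHom.exists_eventually_const {L : Type*} [PartialOrder L] [WellFoundedGT L]
    (w : ℕ →o L) : ∃ N, ∀ j, N ≤ j → w j = w N := by
  obtain ⟨N, hN⟩ := WellFoundedGT.monotone_chain_condition w
  exact ⟨N, fun j hj ↦ (hN j hj).symm⟩

/-- Over a poset with the ascending chain condition, passing to monotone sequences raises the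
deviation by at most one. -/
theorem DeviationLT.orderHom {L : Type*} [PartialOrder L] [WellFoundedGT L] {m : ℕ}
    {u v : ℕ →o L} (h : ∀ j, DeviationLT m (u j) (v j)) : DeviationLT (m + 1) u v := by
  induction m generalizing u v with
  | zero =>
    refine fun c hc huv ↦ Eventually.of_forall fun i hlt ↦ ?_
    refine hlt.ne (OrderHom.ext _ _ (funext fun j ↦ ?_))
    refine (OrderHom.le_def.1 hlt.le j).eq_of_not_lt fun hj ↦ h j ?_
    exact (OrderHom.le_def.1 (huv (i + 1)).1 j).trans_lt
      (hj.trans_le (OrderHom.le_def.1 (huv i).2 j))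
  | succ m ih =>
    intro c hc huv
    choose N hN using fun i ↦ (c i).exists_eventually_const
    obtain ⟨Nu, hNu⟩ := u.exists_eventually_const
    obtain ⟨Nv, hNv⟩ := v.exists_eventually_const
    have lim : ∀ i i', i ≤ i' → c i' (N i') ≤ c i (N i) := by
      intro i i' hi
      rw [← hN i' (max (N i) (N i')) (le_max_right _ _),
        ← hN i (max (N i) (N i')) (le_max_left _ _)]
      exact OrderHom.le_def.1 (hc hi) _
    -- At this index `u` and `v` have both reached their limits, so the interval there contains the
    -- limits of all the `c i`.
    have hlim := h (max Nu Nv) (fun i ↦ c i (N i)) lim fun i ↦ by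
      constructor
      · rw [hNu _ (le_max_left _ _), ← hNu (max Nu (N i)) (le_max_left _ _),
          ← hN i (max Nu (N i)) (le_max_right _ _)]
        exact OrderHom.le_def.1 (huv i).1 _
      · rw [hNv _ (le_max_right _ _), ← hNv (max Nv (N i)) (le_max_left _ _),
          ← hN i (max Nv (N i)) (le_max_right _ _)]
        exact OrderHom.le_def.1 (huv i).2 _
    refine hlim.mono fun i hi ↦ ?_
    -- From `M` on, both sequences equal their limits, so the induction hypothesis bounds the tails.
    -- Only finitely many entries precede `M`, each bounded by `h`.
    set M := max (N i) (N (i + 1))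
    have tail : DeviationLT (m + 1) (seqTail M (c (i + 1))) (seqTail M (c i)) := ih fun j ↦ by
      have h1 : seqTail M (c (i + 1)) j = c (i + 1) (N (i + 1)) := hN _ _ (by lia)
      have h2 : seqTail M (c i) j = c i (N i) := hN _ _ (by lia)
      rwa [h1, h2]
    have head (j : ℕ) : DeviationLT (m + 1) (c (i + 1) j) (c i j) :=
      (h j).mono (OrderHom.le_def.1 (huv (i + 1)).1 j) (OrderHom.le_def.1 (huv i).2 j)
    refine DeviationLT.of_jointly_strictMono (fun (j : Fin M) (w : ℕ →o L) ↦ w j) (seqTail M)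
      (fun j _ _ hw ↦ OrderHom.le_def.1 hw _) (fun _ _ hw j ↦ OrderHom.le_def.1 hw _)
      (fun x y hxy ↦ ?_) (fun j ↦ head j) tail
    by_contra! hne
    refine hxy.ne (OrderHom.ext _ _ (funext fun j ↦ ?_))
    rcases lt_or_ge j M with hj | hj
    · exact (OrderHom.le_def.1 hxy.le j).eq_of_not_lt (hne.2 ⟨j, hj⟩)
    · have hle : seqTail M x ≤ seqTail M y := fun j ↦ OrderHom.le_def.1 hxy.le _
      have := DFunLike.congr_fun (hle.eq_of_not_lt hne.1) (j - M)
      change x (M + (j - M)) = y (M + (j - M)) at this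
      rwa [Nat.add_sub_cancel' hj] at this

/-- The diagonal of an ascending chain of sequences stabilises, which fixes all entries with both
indices large. The finitely many remaining columns stabilise one by one. -/
theorem wellFoundedGT_natOrderHom {L : Type*} [PartialOrder L] [WellFoundedGT L] :
    WellFoundedGT (ℕ →o L) := by
  rw [wellFoundedGT_iff_monotone_chain_condition]
  intro a
  let d : ℕ →o L := ⟨fun i ↦ a i i, fun i j h ↦
    (OrderHom.le_def.1 (a.monotone h) i).trans ((a j).monotone h)⟩
  obtain ⟨N, hN⟩ := d.exists_eventually_const
  have hd (i j) (hi : N ≤ i) (hj : N ≤ j) : a i j = a N N := by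
    refine le_antisymm ?_ ((OrderHom.le_def.1 (a.monotone hi) N).trans ((a i).monotone hj))
    have := hN (max i j) (by lia)
    change a _ _ = a _ _ at this
    rw [← this]
    exact (OrderHom.le_def.1 (a.monotone (le_max_left i j)) j).trans
      ((a _).monotone (le_max_right _ _))
  choose K hK using fun j ↦ OrderHom.exists_eventually_const
    (⟨fun i ↦ a i j, fun i i' h ↦ OrderHom.le_def.1 (a.monotone h) j⟩ : ℕ →o L)
  refine ⟨max N ((Finset.range N).sup K), fun i hi ↦ OrderHom.ext _ _ (funext fun j ↦ ?_)⟩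
  rcases le_or_gt N j with hj | hj
  · rw [hd _ j (le_max_left _ _) hj, hd i j (by lia) hj]
  · have hKj : K j ≤ (Finset.range N).sup K := Finset.le_sup (Finset.mem_range.2 hj)
    exact (hK j _ (hKj.trans (le_max_right _ _))).trans (hK j i (by lia)).symm

/-! ### Coefficients, leading terms and units in `A[t; σ]` -/

noncomputable section

namespace SkewExt

variable {k : Type u} [Field k] {A : Type v} [Ring A] [Algebra k A] (σ : A ≃ₐ[k] A)

/-- The coefficient of `t ^ n`. -/
def coeff (f : SkewExt σ) (n : ℕ) : A := SkewPolynomial.coeff (R := A) f n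

variable {σ}

theorem ext {f g : SkewExt σ} (h : ∀ n, coeff σ f n = coeff σ g n) : f = g :=
  SkewMonoidAlgebra.ext fun n ↦ h n.toAdd

theorem coeff_zero (n : ℕ) : coeff σ 0 n = 0 := rfl

theorem coeff_add (f g : SkewExt σ) (n : ℕ) : coeff σ (f + g) n = coeff σ f n + coeff σ g n :=
  SkewPolynomial.coeff_add ..

theorem coeff_neg (f : SkewExt σ) (n : ℕ) : coeff σ (-f) n = -coeff σ f n :=
  SkewPolynomial.coeff_neg ..

theorem coeff_sub (f g : SkewExt σ) (n : ℕ) : coeff σ (f - g) n = coeff σ f n - coeff σ g n := by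
  rw [sub_eq_add_neg, coeff_add, coeff_neg, sub_eq_add_neg]

theorem coeff_mul (f g : SkewExt σ) (n : ℕ) :
    coeff σ (f * g) n = ∑ p ∈ Finset.HasAntidiagonal.antidiagonal n, coeff σ f p.1 * (σ ^ p.1) (coeff σ g p.2) := by
  let := skewAction σ
  have := SkewMonoidAlgebra.coeff_mul_antidiagonal_of_finset (k := A) (G := Multiplicative ℕ) f g
    (Multiplicative.ofAdd n) (show Finset (ℕ × ℕ) from Finset.HasAntidiagonal.antidiagonal n)
    (fun {p} ↦ Finset.HasAntidiagonal.mem_antidiagonal (n := n) (a := (p : ℕ × ℕ)))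
  exact this

theorem coeff_C (a : A) (n : ℕ) : coeff σ (C σ a) n = if n = 0 then a else 0 :=
  SkewPolynomial.coeff_C

theorem coeff_t (n : ℕ) : coeff σ (t σ) n = if 1 = n then 1 else 0 :=
  SkewPolynomial.coeff_X

theorem algebraMap_eq (c : k) : algebraMap k (SkewExt σ) c = C σ (algebraMap k A c) := by
  let := skewAction σ
  have : SMulCommClass (Multiplicative ℕ) k A :=
    ⟨fun n c a => map_smul (powersHom (A ≃ₐ[k] A) σ n) c a⟩
  exact congrFun (SkewMonoidAlgebra.coe_algebraMap (k := k) (A := A) (G := Multiplicative ℕ)) c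

theorem exists_coeff_eq_zero (f : SkewExt σ) : ∃ d, ∀ m, d ≤ m → coeff σ f m = 0 := by
  obtain ⟨d, hd⟩ := (SkewPolynomial.support (R := A) f).bddAbove
  refine ⟨d + 1, fun m hm ↦ ?_⟩
  by_contra h
  have := hd (SkewPolynomial.mem_support_iff.2 h)
  lia

theorem coeff_C_mul (a : A) (f : SkewExt σ) (n : ℕ) :
    coeff σ (C σ a * f) n = a * coeff σ f n := by
  rw [coeff_mul, Finset.sum_eq_single (0, n)]
  · simp [coeff_C]
  · rintro ⟨i, j⟩ hij hne
    have : i ≠ 0 := by rintro rfl; simp_all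
    simp [coeff_C, this]
  · simp

theorem coeff_mul_C (a : A) (f : SkewExt σ) (n : ℕ) :
    coeff σ (f * C σ a) n = coeff σ f n * (σ ^ n) a := by
  rw [coeff_mul, Finset.sum_eq_single (n, 0)]
  · simp [coeff_C]
  · rintro ⟨i, j⟩ hij hne
    have : j ≠ 0 := by rintro rfl; simp_all
    simp [coeff_C, this]
  · simp

theorem coeff_mul_t_succ (f : SkewExt σ) (n : ℕ) :
    coeff σ (f * t σ) (n + 1) = coeff σ f n := by
  rw [coeff_mul, Finset.sum_eq_single (n, 1)]
  · simp [coeff_t]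
  · rintro ⟨i, j⟩ hij hne
    have : 1 ≠ j := by rintro rfl; simp_all
    simp [coeff_t, this]
  · simp

theorem coeff_mul_t_zero (f : SkewExt σ) : coeff σ (f * t σ) 0 = 0 := by
  simp [coeff_mul, coeff_t]

theorem coeff_C_mul_t_pow (a : A) (n m : ℕ) :
    coeff σ (C σ a * t σ ^ n) m = if m = n then a else 0 := by
  induction n generalizing m with
  | zero => simp [coeff_C]
  | succ n ih =>
    rw [pow_succ, ← mul_assoc]
    cases m with
    | zero => simp [coeff_mul_t_zero]
    | succ m => simp [coeff_mul_t_succ, ih]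

/-- Induction principle: the constants generate `A[t; σ]` under addition and right multiplication
by `t`. -/
theorem induction_mul_t {p : SkewExt σ → Prop} (hC : ∀ a, p (C σ a))
    (hadd : ∀ f g, p f → p g → p (f + g)) (ht : ∀ f, p f → p (f * t σ)) (f : SkewExt σ) : p f := by
  suffices H : ∀ d, ∀ f : SkewExt σ, (∀ m, d ≤ m → coeff σ f m = 0) → p f by
    obtain ⟨d, hd⟩ := exists_coeff_eq_zero f
    exact H d f hd
  intro d
  induction d with
  | zero =>
    intro f hf
    rw [show f = C σ 0 from ext fun n ↦ by simp [hf, coeff_zero]]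
    exact hC 0
  | succ d ih =>
    intro f hf
    have hmon : ∀ n, p (C σ (coeff σ f d) * t σ ^ n) := fun n ↦ by
      induction n with
      | zero => simpa using hC _
      | succ n ih => rw [pow_succ, ← mul_assoc]; exact ht _ ih
    rw [← sub_add_cancel f (C σ (coeff σ f d) * t σ ^ d)]
    refine hadd _ _ (ih _ fun m hm ↦ ?_) (hmon d)
    rw [coeff_sub, coeff_C_mul_t_pow]
    rcases hm.eq_or_lt with rfl | hm
    · simp
    · simp [hf m hm, hm.ne']

variable (σ) in
/-- The inclusion of the constants, as an algebra homomorphism. -/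
def constHom : A →ₐ[k] SkewExt σ :=
  { C σ with commutes' := fun c ↦ (algebraMap_eq c).symm }

variable (σ) in
/-- The augmentation `t ↦ 0`, as an algebra homomorphism. -/
def augmentation : SkewExt σ →ₐ[k] A where
  toFun f := coeff σ f 0
  map_one' := by simpa [coeff_C] using coeff_C (σ := σ) (1 : A) 0
  map_mul' f g := by simp [coeff_mul]
  map_zero' := rfl
  map_add' _ _ := coeff_add ..
  commutes' c := by simp [algebraMap_eq, coeff_C]

theorem augmentation_constHom (a : A) : augmentation σ (constHom σ a) = a := by
  change coeff σ (C σ a) 0 = a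
  simp [coeff_C]

theorem exists_leading_coeff {f : SkewExt σ} (hf : f ≠ 0) :
    ∃ n, coeff σ f n ≠ 0 ∧ ∀ m, n < m → coeff σ f m = 0 := by
  classical
  have h := exists_coeff_eq_zero f
  rcases hd : Nat.find h with _ | d
  · exact absurd (ext fun n ↦ (Nat.find_spec h n (by lia)).trans (coeff_zero n).symm) hf
  · refine ⟨d, fun h0 ↦ Nat.find_min h (m := d) (by lia) fun m hm ↦ ?_,
      fun m hm ↦ Nat.find_spec h m (by lia)⟩
    rcases hm.eq_or_lt with rfl | hm
    exacts [h0, Nat.find_spec h m (by lia)]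

theorem coeff_mul_leading {f g : SkewExt σ} {m n : ℕ} (hf : ∀ i, m < i → coeff σ f i = 0)
    (hg : ∀ i, n < i → coeff σ g i = 0) :
    coeff σ (f * g) (m + n) = coeff σ f m * (σ ^ m) (coeff σ g n) := by
  rw [coeff_mul, Finset.sum_eq_single (m, n)]
  · rintro ⟨i, j⟩ hij hne
    rw [Finset.HasAntidiagonal.mem_antidiagonal] at hij
    rcases lt_trichotomy i m with h | h | h
    · simp [hg j (by simp at hij; lia)]
    · exact absurd (by simp at hij; simp; lia) hne
    · simp [hf i h]
  · simp

instance [IsDomain A] : IsDomain (SkewExt σ) := by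
  have : Nontrivial (SkewExt σ) := (augmentation σ).toRingHom.domain_nontrivial
  have : NoZeroDivisors (SkewExt σ) := ⟨fun {f g} h ↦ by
    by_contra! hne
    obtain ⟨m, hm, hm'⟩ := exists_leading_coeff hne.1
    obtain ⟨n, hn, hn'⟩ := exists_leading_coeff hne.2
    have := coeff_mul_leading hm' hn'
    rw [h, coeff_zero] at this
    exact mul_ne_zero hm ((map_ne_zero_iff _ (σ ^ m).injective).2 hn) this.symm⟩
  exact NoZeroDivisors.to_isDomain _

/-- Degrees add over a domain, so a unit has degree zero and equals its constant term, a unit of `A`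
by augmentation. -/
theorem exists_algebraMap_of_isUnit [IsDomain A]
    (hA : ∀ a : A, IsUnit a → ∃ c : k, algebraMap k A c = a) (f : SkewExt σ) (hf : IsUnit f) :
    ∃ c : k, algebraMap k (SkewExt σ) c = f := by
  obtain ⟨g, hfg, hgf⟩ := isUnit_iff_exists.1 hf
  have hf0 : f ≠ 0 := hf.ne_zero
  have hg0 : g ≠ 0 := by rintro rfl; simp at hfg
  obtain ⟨m, hm, hm'⟩ := exists_leading_coeff hf0
  obtain ⟨n, hn, hn'⟩ := exists_leading_coeff hg0
  have key := coeff_mul_leading hm' hn'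
  have hmn : m = 0 := by
    by_contra h
    rw [hfg, ← map_one (C σ), coeff_C, if_neg (by lia)] at key
    exact mul_ne_zero hm ((map_ne_zero_iff _ (σ ^ m).injective).2 hn) key.symm
  obtain ⟨c, hc⟩ := hA (augmentation σ f) (hf.map (augmentation σ))
  refine ⟨c, ext fun i ↦ ?_⟩
  rw [algebraMap_eq, coeff_C, hc]
  split_ifs with h
  · rw [h]; rfl
  · exact (hm' i (by lia)).symm

/-! ### Two-sided ideals of `A[t; σ]` compared with those of `A` -/

/-- The leading coefficients of the elements of degree `j` (and zero) in a two-sided ideal. -/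
def leadingIdeal (I : TwoSidedIdeal (SkewExt σ)) (j : ℕ) : TwoSidedIdeal A :=
  .mk' {a | ∃ f ∈ I, (∀ m, j < m → coeff σ f m = 0) ∧ coeff σ f j = a}
    ⟨0, I.zero_mem, fun _ _ ↦ rfl, rfl⟩
    (by
      rintro _ _ ⟨f, hf, hf', rfl⟩ ⟨g, hg, hg', rfl⟩
      exact ⟨f + g, I.add_mem hf hg, fun m hm ↦ by simp [coeff_add, hf' m hm, hg' m hm], coeff_add ..⟩)
    (by
      rintro _ ⟨f, hf, hf', rfl⟩
      exact ⟨-f, I.neg_mem hf, fun m hm ↦ by simp [coeff_neg, hf' m hm], coeff_neg ..⟩)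
    (by
      rintro a _ ⟨f, hf, hf', rfl⟩
      exact ⟨C σ a * f, I.mul_mem_left _ _ hf, fun m hm ↦ by simp [coeff_C_mul, hf' m hm],
        coeff_C_mul _ _ _⟩)
    (by
      rintro _ a ⟨f, hf, hf', rfl⟩
      -- Moving a constant past `t ^ j` applies `σ ^ j`, so the multiplier is untwisted in advance.
      refine ⟨f * C σ ((σ ^ j).symm a), I.mul_mem_right _ _ hf,
        fun m hm ↦ by simp [coeff_mul_C, hf' m hm], ?_⟩
      rw [coeff_mul_C, AlgEquiv.apply_symm_apply])

theorem mem_leadingIdeal {I : TwoSidedIdeal (SkewExt σ)} {j : ℕ} {a : A} :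
    a ∈ leadingIdeal I j ↔ ∃ f ∈ I, (∀ m, j < m → coeff σ f m = 0) ∧ coeff σ f j = a :=
  TwoSidedIdeal.mem_mk' ..

/-- The increasing sequence of leading coefficient ideals. -/
def leadingIdeals (I : TwoSidedIdeal (SkewExt σ)) : ℕ →o TwoSidedIdeal A :=
  ⟨leadingIdeal I, monotone_nat_of_le_succ fun j a ha ↦ by
    obtain ⟨f, hf, hf', rfl⟩ := mem_leadingIdeal.1 ha
    refine mem_leadingIdeal.2 ⟨f * t σ, I.mul_mem_right _ _ hf, fun m hm ↦ ?_,
      coeff_mul_t_succ _ _⟩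
    obtain ⟨m, rfl⟩ := Nat.exists_eq_add_of_lt hm
    rw [coeff_mul_t_succ]
    exact hf' _ (by lia)⟩

/-- The argument of Hilbert's basis theorem: if the leading ideals agree, subtracting an element of
the smaller ideal with the same leading term lowers the degree. -/
theorem leadingIdeals_strictMono :
    StrictMono (leadingIdeals : TwoSidedIdeal (SkewExt σ) → ℕ →o TwoSidedIdeal A) := by
  intro I J hIJ
  have hle : leadingIdeals I ≤ leadingIdeals J := fun j a ha ↦ by
    obtain ⟨f, hf, hf'⟩ := mem_leadingIdeal.1 ha
    exact mem_leadingIdeal.2 ⟨f, hIJ.le hf, hf'⟩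
  refine hle.lt_of_ne fun heq ↦ hIJ.not_ge fun f hf ↦ ?_
  suffices H : ∀ d, ∀ f ∈ J, (∀ m, d ≤ m → coeff σ f m = 0) → f ∈ I by
    obtain ⟨d, hd⟩ := exists_coeff_eq_zero f
    exact H d f hf hd
  intro d
  induction d with
  | zero =>
    intro f _ hf
    rw [show f = 0 from ext fun n ↦ by simp [hf, coeff_zero]]
    exact I.zero_mem
  | succ d ih =>
    intro f hfJ hf
    have hmem : coeff σ f d ∈ leadingIdeals J d := mem_leadingIdeal.2 ⟨f, hfJ, hf, rfl⟩
    rw [← heq] at hmem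
    obtain ⟨g, hgI, hg, hgf⟩ := mem_leadingIdeal.1 hmem
    rw [← sub_add_cancel f g]
    refine I.add_mem (ih _ (J.sub_mem hfJ (hIJ.le hgI)) fun m hm ↦ ?_) hgI
    rw [coeff_sub]
    rcases hm.eq_or_lt with rfl | hm
    · rw [hgf, sub_self]
    · rw [hf m hm, hg m hm, sub_self]

/-- The elements of `t`-order at least `i` whose coefficient of `t ^ i` lies in a given ideal. -/
def orderIdeal (i : ℕ) (I : TwoSidedIdeal A) : TwoSidedIdeal (SkewExt σ) :=
  .mk' {f | (∀ m < i, coeff σ f m = 0) ∧ coeff σ f i ∈ I}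
    ⟨fun _ _ ↦ rfl, I.zero_mem⟩
    (fun {f g} hf hg ↦
      ⟨fun m hm ↦ by simp [coeff_add, hf.1 m hm, hg.1 m hm], by
        rw [coeff_add]; exact I.add_mem hf.2 hg.2⟩)
    (fun {f} hf ↦ ⟨fun m hm ↦ by simp [coeff_neg, hf.1 m hm], by
      rw [coeff_neg]; exact I.neg_mem hf.2⟩)
    (fun {f g} hg ↦ by
      constructor
      · intro m hm
        rw [coeff_mul]
        refine Finset.sum_eq_zero fun p hp ↦ ?_
        rw [hg.1 p.2 (by rw [Finset.HasAntidiagonal.mem_antidiagonal] at hp; lia)]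
        simp
      -- The lowest coefficient is `f₀ gᵢ` here and `fᵢ σ ^ i (g₀)` for right multiplication: `σ`
      -- never acts on the factor in `I`, so `I` need not be `σ`-stable.
      · rw [coeff_mul, Finset.sum_eq_single (0, i)]
        · simpa using I.mul_mem_left _ _ hg.2
        · rintro ⟨p, q⟩ hp hne
          rw [Finset.HasAntidiagonal.mem_antidiagonal] at hp
          rw [hg.1 q (by
            by_contra h
            exact hne (by simp at hp; simp; lia))]
          simp
        · simp)
    (fun {f g} hf ↦ by
      constructor
      · intro m hm
        rw [coeff_mul]
        refine Finset.sum_eq_zero fun p hp ↦ ?_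
        rw [hf.1 p.1 (by rw [Finset.HasAntidiagonal.mem_antidiagonal] at hp; lia)]
        simp
      · rw [coeff_mul, Finset.sum_eq_single (i, 0)]
        · simpa using I.mul_mem_right _ _ hf.2
        · rintro ⟨p, q⟩ hp hne
          rw [Finset.HasAntidiagonal.mem_antidiagonal] at hp
          rw [hf.1 p (by
            by_contra h
            exact hne (by simp at hp; simp; lia))]
          simp
        · simp)

theorem mem_orderIdeal {i : ℕ} {I : TwoSidedIdeal A} {f : SkewExt σ} :
    f ∈ orderIdeal i I ↔ (∀ m < i, coeff σ f m = 0) ∧ coeff σ f i ∈ I :=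
  TwoSidedIdeal.mem_mk' ..

theorem orderIdeal_strictMono (i : ℕ) :
    StrictMono (orderIdeal i : TwoSidedIdeal A → TwoSidedIdeal (SkewExt σ)) := by
  refine Monotone.strictMono_of_injective (fun I J hIJ f hf ↦ ?_) fun I J h ↦ ?_
  · rw [mem_orderIdeal] at hf ⊢
    exact ⟨hf.1, hIJ hf.2⟩
  · have key (K : TwoSidedIdeal A) (a : A) :
        C σ a * t σ ^ i ∈ orderIdeal (σ := σ) i K ↔ a ∈ K := by
      rw [mem_orderIdeal]
      simp only [coeff_C_mul_t_pow, if_true, and_iff_right_iff_imp]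
      exact fun _ m hm ↦ if_neg hm.ne
    ext a
    rw [← key I, ← key J, h]

/-- Consecutive terms of the filtration by order are thus the images of `⊥` and `⊤` under a single
`orderIdeal i`. -/
theorem orderIdeal_succ_top (i : ℕ) :
    (orderIdeal (i + 1) ⊤ : TwoSidedIdeal (SkewExt σ)) = orderIdeal i ⊥ := by
  ext f
  simp only [mem_orderIdeal, TwoSidedIdeal.mem_top, and_true, TwoSidedIdeal.mem_bot,
    Nat.lt_succ_iff_lt_or_eq]
  exact ⟨fun h ↦ ⟨fun m hm ↦ h m (.inl hm), h i (.inr rfl)⟩,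
    fun h m hm ↦ hm.elim (h.1 m) fun e ↦ e ▸ h.2⟩

end SkewExt
end

/-! ### Normal elements -/

/-- Since `σ` is invertible, constants move past `t` from left to right as well. -/
theorem SkewExt.exists_mul_t_eq {k : Type u} [Field k] {A : Type v} [Ring A] [Algebra k A]
    {σ : A ≃ₐ[k] A} (f : SkewExt σ) : ∃ g, f * t σ = t σ * g := by
  induction f using SkewExt.induction_mul_t with
  | hC a => exact ⟨C σ (σ.symm a), by rw [t_mul_C, AlgEquiv.apply_symm_apply]⟩
  | hadd f g hf hg =>
    obtain ⟨f', hf⟩ := hf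
    obtain ⟨g', hg⟩ := hg
    exact ⟨f' + g', by rw [add_mul, hf, hg, mul_add]⟩
  | ht f hf =>
    obtain ⟨g, hg⟩ := hf
    exact ⟨g * t σ, by rw [hg, mul_assoc]⟩

/-- In a domain with the descending chain condition on two-sided ideals, every nonzero `b` with
`B b ⊆ b B` is a unit. -/
theorem isUnit_of_deviationLT_one {B : Type*} [Ring B] [IsDomain B]
    (hB : DeviationLT 1 (⊥ : TwoSidedIdeal B) ⊤) {b : B} (hb : b ≠ 0)
    (hnormal : ∀ x, ∃ y, x * b = b * y) : IsUnit b := by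
  have hpow (i : ℕ) (x : B) : ∃ y, x * b ^ i = b ^ i * y := by
    induction i with
    | zero => exact ⟨x, by simp⟩
    | succ i ih =>
      obtain ⟨y, hy⟩ := ih
      obtain ⟨z, hz⟩ := hnormal y
      exact ⟨z, by rw [pow_succ, ← mul_assoc, hy, mul_assoc, hz, ← mul_assoc]⟩
  let c (i : ℕ) : TwoSidedIdeal B := .mk' {z | ∃ x, b ^ i * x = z} ⟨0, mul_zero _⟩
    (by rintro _ _ ⟨x, rfl⟩ ⟨y, rfl⟩; exact ⟨x + y, mul_add ..⟩)
    (by rintro _ ⟨x, rfl⟩; exact ⟨-x, mul_neg ..⟩)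
    (by
      rintro r _ ⟨x, rfl⟩
      obtain ⟨y, hy⟩ := hpow i r
      exact ⟨y * x, by rw [← mul_assoc, ← mul_assoc, hy]⟩)
    (by rintro _ r ⟨x, rfl⟩; exact ⟨x * r, (mul_assoc ..).symm⟩)
  have hc {i : ℕ} {z : B} : z ∈ c i ↔ ∃ x, b ^ i * x = z := TwoSidedIdeal.mem_mk' ..
  have hanti (i : ℕ) : c (i + 1) ≤ c i := fun z hz ↦ by
    obtain ⟨x, rfl⟩ := hc.1 hz
    exact hc.2 ⟨b * x, by rw [pow_succ, mul_assoc]⟩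
  obtain ⟨i, hi⟩ := (hB c (antitone_nat_of_succ_le hanti) fun _ ↦ ⟨bot_le, le_top⟩).exists
  have hmem : b ^ i ∈ c (i + 1) := by
    rw [(hanti i).eq_of_not_lt hi]
    exact hc.2 ⟨1, mul_one _⟩
  obtain ⟨x, hx⟩ := hc.1 hmem
  have hbx : b * x = 1 := by
    refine mul_left_cancel₀ (pow_ne_zero i hb) ?_
    rw [← mul_assoc, ← pow_succ, hx, mul_one]
  refine isUnit_iff_exists.2 ⟨x, hbx, mul_left_cancel₀ hb ?_⟩
  rw [← mul_assoc, hbx, one_mul, mul_one]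

/-! ### Induction along towers -/

namespace SkewTower

variable {k : Type u} [Field k]

theorem isDomain_total {A : Type v} [Ring A] [Algebra k A] {n : ℕ} (T : SkewTower k A n)
    (hA : IsDomain A) : IsDomain T.total := by
  induction T with
  | nil => exact hA
  | cons σ T ih => exact ih inferInstance

theorem exists_algebraMap_total {A : Type v} [Ring A] [Algebra k A] {n : ℕ}
    (T : SkewTower k A n) (hdom : IsDomain A) (hA : ∀ a : A, IsUnit a → ∃ c : k, algebraMap k A c = a)
    (f : T.total) (hf : IsUnit f) : ∃ c : k, algebraMap k T.total c = f := by
  induction T with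
  | nil => exact hA f hf
  | cons σ T ih => exact ih inferInstance (SkewExt.exists_algebraMap_of_isUnit hA) f hf

theorem exists_retraction {A : Type v} [Ring A] [Algebra k A] {n : ℕ} (T : SkewTower k A n) :
    ∃ (ι : A →ₐ[k] T.total) (ε : T.total →ₐ[k] A), ∀ a, ε (ι a) = a := by
  induction T with
  | nil => exact ⟨AlgHom.id k _, AlgHom.id k _, fun _ ↦ rfl⟩
  | cons σ T ih =>
    obtain ⟨ι, ε, h⟩ := ih
    exact ⟨ι.comp (SkewExt.constHom σ), (SkewExt.augmentation σ).comp ε, fun a ↦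
      (congrArg (SkewExt.augmentation σ) (h _)).trans (SkewExt.augmentation_constHom a)⟩

/-- The ascending chain condition passes to each extension through leading ideals, so
`DeviationLT.orderHom` applies again for the next variable. -/
theorem deviationLT_total {A : Type v} [Ring A] [Algebra k A] {n : ℕ} (T : SkewTower k A n)
    (hA : WellFoundedGT (TwoSidedIdeal A)) {m : ℕ} (h : DeviationLT m (⊥ : TwoSidedIdeal A) ⊤) :
    DeviationLT (m + n) (⊥ : TwoSidedIdeal T.total) ⊤ := by
  induction T generalizing m with
  | nil => exact h
  | @cons A _ _ n σ T ih =>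
    have : WellFoundedGT (ℕ →o TwoSidedIdeal A) := wellFoundedGT_natOrderHom
    have : WellFoundedGT (TwoSidedIdeal (SkewExt σ)) :=
      SkewExt.leadingIdeals_strictMono.wellFoundedGT
    rw [show m + (n + 1) = m + 1 + n by lia]
    exact ih ‹_› (.of_strictMono SkewExt.leadingIdeals_strictMono
      (.orderHom fun _ ↦ h.mono bot_le le_top))

/-- In the filtration by order in `t`, some layer must have deviation less than `m`, and every layer
contains a copy of the ideal lattice of `A`. No ascending chain condition enters, which allows its
use for an arbitrary `B`. -/
theorem deviationLT_of_total {A : Type v} [Ring A] [Algebra k A] {n : ℕ} (T : SkewTower k A n)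
    {m : ℕ} (h : DeviationLT (m + n) (⊥ : TwoSidedIdeal T.total) ⊤) :
    DeviationLT m (⊥ : TwoSidedIdeal A) ⊤ := by
  induction T generalizing m with
  | nil => exact h
  | @cons A _ _ n σ T ih =>
    rw [show m + (n + 1) = m + 1 + n by lia] at h
    have hanti : Antitone fun i ↦ (SkewExt.orderIdeal i ⊤ : TwoSidedIdeal (SkewExt σ)) :=
      antitone_nat_of_succ_le fun i ↦ by
        rw [SkewExt.orderIdeal_succ_top]
        exact (SkewExt.orderIdeal_strictMono i).monotone bot_le
    obtain ⟨i, hi⟩ := (ih h _ hanti fun _ ↦ ⟨bot_le, le_top⟩).exists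
    rw [SkewExt.orderIdeal_succ_top] at hi
    exact .of_strictMono (SkewExt.orderIdeal_strictMono i) hi

/-- If every nonzero `b : B` with `B b ⊆ b B` is a scalar, then a quotient of an iterated skew
polynomial extension of `A` which is isomorphic to `B` is already a quotient of `A`. -/
theorem exists_surjective_of_total {B : Type*} [Ring B] [Algebra k B]
    (hB : ∀ b : B, (∀ x, ∃ y, x * b = b * y) → ∃ c : k, algebraMap k B c = b)
    {A : Type v} [Ring A] [Algebra k A] {n : ℕ} (T : SkewTower k A n)
    (φ : T.total →ₐ[k] B) (hφ : Function.Surjective φ) :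
    ∃ ψ : A →ₐ[k] B, Function.Surjective ψ := by
  induction T with
  | nil => exact ⟨φ, hφ⟩
  | cons σ T ih =>
    obtain ⟨ψ, hψ⟩ := ih φ hφ
    -- Normality of `t` passes to its image because `ψ` is surjective. Once `t` maps to a scalar,
    -- the constants already fill the image.
    obtain ⟨c, hc⟩ := hB (ψ (SkewExt.t σ)) fun x ↦ by
      obtain ⟨f, rfl⟩ := hψ x
      obtain ⟨g, hg⟩ := f.exists_mul_t_eq
      exact ⟨ψ g, by rw [← map_mul, hg, map_mul]⟩
    refine ⟨ψ.comp (SkewExt.constHom σ), fun b ↦ ?_⟩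
    obtain ⟨f, rfl⟩ := hψ b
    change ∃ a, ψ (SkewExt.constHom σ a) = ψ f
    induction f using SkewExt.induction_mul_t with
    | hC a => exact ⟨a, rfl⟩
    | hadd f g hf hg =>
      obtain ⟨a, ha⟩ := hf
      obtain ⟨b, hb⟩ := hg
      exact ⟨a + b, by rw [map_add, map_add, map_add, ha, hb]⟩
    | ht f hf =>
      obtain ⟨a, ha⟩ := hf
      refine ⟨a * algebraMap k _ c, ?_⟩
      rw [map_mul, map_mul, map_mul, ha, ← hc, AlgHom.commutes, AlgHom.commutes]

end SkewTower

/-! ### Cancellation for simple domains -/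

/-- A simple domain whose only units are the scalars is strongly `σ`-cancellative. -/
theorem StronglySigmaCancellative.of_isSimpleRing (k : Type u) [Field k] (A : Type v) [Ring A]
    [Algebra k A] [IsDomain A] [IsSimpleRing A]
    (hA : ∀ a : A, IsUnit a → ∃ c : k, algebraMap k A c = a) :
    StronglySigmaCancellative.{u, v, w} k A := by
  rintro B _ _ n - S T ⟨e⟩
  obtain ⟨ι, ε, hε⟩ := T.exists_retraction
  have hι : Function.Injective (e.symm.toAlgHom.comp ι) :=
    e.symm.injective.comp (Function.LeftInverse.injective hε)
  have := S.isDomain_total ‹_›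
  have : IsDomain B := hι.isDomain (e.symm.toAlgHom.comp ι).toRingHom
  have hunit (b : B) (hb : IsUnit b) : ∃ c : k, algebraMap k B c = b := by
    obtain ⟨c, hc⟩ := S.exists_algebraMap_total ‹_› hA _ (hb.map (e.symm.toAlgHom.comp ι))
    exact ⟨c, hι (by rw [AlgHom.commutes, hc])⟩
  have : Finite (TwoSidedIdeal A) := IsSimpleOrder.instFinite
  have hdev : DeviationLT 1 (⊥ : TwoSidedIdeal A) ⊤ := by
    intro c hc _
    obtain ⟨N, hN⟩ := WellFoundedGT.monotone_chain_condition (α := (TwoSidedIdeal A)ᵒᵈ)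
      ⟨fun i ↦ OrderDual.toDual (c i), hc⟩
    filter_upwards [Filter.eventually_ge_atTop N] with i hi
    have h : c (i + 1) = c i := (hN (i + 1) (by lia)).symm.trans (hN i hi)
    exact h.not_lt
  have hdevS := S.deviationLT_total inferInstance hdev
  have hdevT : DeviationLT (1 + n) (⊥ : TwoSidedIdeal T.total) ⊤ := by
    refine .of_strictMono e.symm.toRingEquiv.mapTwoSidedIdeal.strictMono ?_
    simpa using hdevS
  have hdevB : DeviationLT 1 (⊥ : TwoSidedIdeal B) ⊤ := T.deviationLT_of_total hdevT
  -- The variables over `A` may map to zero, which is a scalar but not a unit.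
  obtain ⟨ψ, hψ⟩ := S.exists_surjective_of_total (B := B) (fun b hb ↦ by
      rcases eq_or_ne b 0 with rfl | h0
      · exact ⟨0, map_zero _⟩
      · exact hunit b (isUnit_of_deviationLT_one hdevB h0 hb))
    (ε.comp e.toAlgHom) ((Function.RightInverse.surjective hε).comp e.surjective)
  exact ⟨AlgEquiv.ofBijective ψ ⟨ψ.toRingHom.injective, hψ⟩⟩

/-! ### The first Weyl algebra: domain, units, simplicity -/

noncomputable section

open Polynomial in
/-- The action of the first Weyl algebra on `k[X]` in which `x` acts by differentiation and `y` by
multiplication by `X`. -/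
def FirstWeylAlgebra.action (k : Type u) [Field k] :
    FirstWeylAlgebra k →ₐ[k] Module.End k k[X] :=
  RingQuot.liftAlgHom k ⟨FreeAlgebra.lift k ![Polynomial.derivative, LinearMap.mulLeft k X], by
    rintro _ _ ⟨⟩
    refine LinearMap.ext fun p ↦ ?_
    simp [Module.End.mul_apply, derivative_mul]⟩

namespace FirstWeylAlgebra

variable {k : Type u} [Field k]

variable (k) in
/-- The quotient map from the free algebra. -/
def mk : FreeAlgebra k (Fin 2) →ₐ[k] FirstWeylAlgebra k := RingQuot.mkAlgHom k (FirstWeylRel k)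

variable (k) in
/-- The generator `x`. -/
def x : FirstWeylAlgebra k := mk k (FreeAlgebra.ι k 0)

variable (k) in
/-- The generator `y`. -/
def y : FirstWeylAlgebra k := mk k (FreeAlgebra.ι k 1)

theorem x_mul_y : x k * y k = y k * x k + 1 := by
  have h : mk k _ = mk k _ := RingQuot.mkAlgHom_rel k (FirstWeylRel.comm (k := k))
  rw [map_sub, map_mul, map_mul, map_one] at h
  exact sub_eq_iff_eq_add'.1 h

theorem action_y (p : Polynomial k) : action k (y k) p = Polynomial.X * p := by
  have h : action k (y k) = FreeAlgebra.lift k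
      ![Polynomial.derivative, LinearMap.mulLeft k Polynomial.X] (FreeAlgebra.ι k 1) :=
    RingQuot.liftAlgHom_mkAlgHom_apply ..
  rw [h, FreeAlgebra.lift_ι_apply]
  rfl

theorem induction_xy {P : FirstWeylAlgebra k → Prop} (hone : P 1)
    (hsmul : ∀ (c : k) w, P w → P (c • w)) (hadd : ∀ w w', P w → P w' → P (w + w'))
    (hx : ∀ w, P w → P (x k * w)) (hy : ∀ w, P w → P (y k * w)) (w : FirstWeylAlgebra k) :
    P w := by
  obtain ⟨w, rfl⟩ : ∃ v, mk k v = w := RingQuot.mkAlgHom_surjective k (FirstWeylRel k) w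
  -- Letting `w` act by left multiplication makes the product case of the induction a composition.
  suffices H : ∀ v, P v → P (mk k w * v) by
    simpa using H 1 hone
  induction w using FreeAlgebra.induction with
  | grade0 c =>
    intro v hv
    rw [AlgHom.commutes, ← Algebra.smul_def]
    exact hsmul c v hv
  | grade1 i =>
    fin_cases i
    exacts [hx, hy]
  | mul a b ha hb =>
    intro v hv
    rw [map_mul, mul_assoc]
    exact ha _ (hb _ hv)
  | add a b ha hb =>
    intro v hv
    rw [map_add, add_mul]
    exact hadd _ _ (ha _ hv) (hb _ hv)

/-- The polynomial `p(y)`. -/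
def ofPoly : Polynomial k →ₐ[k] FirstWeylAlgebra k := Polynomial.aeval (y k)

theorem ofPoly_X : ofPoly Polynomial.X = y k := Polynomial.aeval_X _

/-- Acting on the polynomial `1`, the element `p(y)` returns `p`. -/
theorem ofPoly_injective : Function.Injective (ofPoly : Polynomial k → FirstWeylAlgebra k) := by
  rw [injective_iff_map_eq_zero]
  intro p hp
  have key (q : Polynomial k) : action k (ofPoly p) q = p * q := by
    clear hp
    induction p using Polynomial.induction_on' with
    | add p₁ p₂ h₁ h₂ => rw [map_add, map_add, LinearMap.add_apply, h₁, h₂, add_mul]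
    | monomial n c =>
      rw [← Polynomial.C_mul_X_pow_eq_monomial, map_mul, map_pow, ofPoly_X,
        ← Polynomial.algebraMap_eq, AlgHom.commutes, map_mul, AlgHom.commutes, map_pow,
        Module.End.mul_apply, Module.algebraMap_end_apply, Algebra.smul_def, mul_assoc]
      congr 1
      induction n with
      | zero => simp
      | succ n ih => rw [pow_succ', Module.End.mul_apply, ih, action_y, pow_succ', mul_assoc]
  have := key 1
  rw [hp, map_zero, mul_one] at this
  exact this.symm

theorem x_mul_ofPoly (p : Polynomial k) :
    x k * ofPoly p = ofPoly p * x k + ofPoly (Polynomial.derivative p) := by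
  induction p using Polynomial.induction_on with
  | C c =>
    rw [Polynomial.derivative_C, map_zero, add_zero, ← Polynomial.algebraMap_eq,
      AlgHom.commutes, Algebra.commutes]
  | add p q hp hq => simp only [map_add, mul_add, add_mul, hp, hq]; abel
  | monomial n c ih =>
    rw [pow_succ, ← mul_assoc, map_mul, ← mul_assoc, ih, add_mul, mul_assoc, ofPoly_X, x_mul_y,
      Polynomial.derivative_mul (f := Polynomial.C c * Polynomial.X ^ n), Polynomial.derivative_X,
      mul_one, map_add, map_mul _ (Polynomial.derivative _), ofPoly_X]
    noncomm_ring

/-- The inner derivation `w ↦ w y - y w`, that is, `∂/∂x`. -/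
def derivX (w : FirstWeylAlgebra k) : FirstWeylAlgebra k := w * y k - y k * w

theorem derivX_add (w w' : FirstWeylAlgebra k) : derivX (w + w') = derivX w + derivX w' := by
  simp only [derivX]; noncomm_ring

theorem derivX_mul (w w' : FirstWeylAlgebra k) :
    derivX (w * w') = derivX w * w' + w * derivX w' := by
  simp only [derivX]; noncomm_ring

theorem derivX_ofPoly (p : Polynomial k) : derivX (ofPoly p) = 0 := by
  rw [derivX, ← ofPoly_X, ← map_mul, ← map_mul, mul_comm, sub_self]

theorem derivX_x : derivX (x k) = 1 := by
  rw [derivX, x_mul_y, add_sub_cancel_left]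

theorem derivX_ofPoly_mul_x_pow (p : Polynomial k) (j : ℕ) :
    derivX (ofPoly p * x k ^ (j + 1)) = ofPoly (((j + 1 : ℕ) : Polynomial k) * p) * x k ^ j := by
  have h (j : ℕ) : derivX (x k ^ (j + 1)) = (j + 1 : ℕ) * x k ^ j := by
    induction j with
    | zero => simp [derivX_x]
    | succ j ih =>
      rw [pow_succ, derivX_mul, ih, derivX_x, mul_assoc, ← pow_succ, mul_one, ← add_one_mul]
      push_cast
      rfl
  rw [derivX_mul, derivX_ofPoly, zero_mul, zero_add, h, map_mul, map_natCast, ← mul_assoc,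
    Nat.cast_comm]

/-- `HasOrderLT d w`: the element `w` has the form `∑ j < d, pⱼ(y) x ^ j`. -/
def HasOrderLT (d : ℕ) (w : FirstWeylAlgebra k) : Prop :=
  ∃ p : ℕ → Polynomial k, w = ∑ j ∈ Finset.range d, ofPoly (p j) * x k ^ j

theorem HasOrderLT.mono {d e : ℕ} (h : d ≤ e) {w : FirstWeylAlgebra k} (hw : HasOrderLT d w) :
    HasOrderLT e w := by
  obtain ⟨p, rfl⟩ := hw
  refine ⟨fun j ↦ if j < d then p j else 0, ?_⟩
  rw [← Finset.sum_subset (Finset.range_mono h)]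
  · exact Finset.sum_congr rfl fun j hj ↦ by simp only [if_pos (Finset.mem_range.1 hj)]
  · intro j _ hj
    simp only [if_neg (mt Finset.mem_range.2 hj), map_zero, zero_mul]

theorem HasOrderLT.add {d : ℕ} {w w' : FirstWeylAlgebra k} (hw : HasOrderLT d w)
    (hw' : HasOrderLT d w') : HasOrderLT d (w + w') := by
  obtain ⟨p, rfl⟩ := hw
  obtain ⟨q, rfl⟩ := hw'
  exact ⟨p + q, by simp only [Pi.add_apply, map_add, add_mul, Finset.sum_add_distrib]⟩

theorem HasOrderLT.ofPoly_mul {d : ℕ} (q : Polynomial k) {w : FirstWeylAlgebra k}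
    (hw : HasOrderLT d w) : HasOrderLT d (ofPoly q * w) := by
  obtain ⟨p, rfl⟩ := hw
  exact ⟨fun j ↦ q * p j, by simp only [map_mul, Finset.mul_sum, mul_assoc]⟩

theorem HasOrderLT.x_mul {d : ℕ} {w : FirstWeylAlgebra k} (hw : HasOrderLT d w) :
    HasOrderLT (d + 1) (x k * w) := by
  obtain ⟨p, rfl⟩ := hw
  have h1 : HasOrderLT (d + 1) (∑ j ∈ Finset.range d, ofPoly (p j) * x k ^ (j + 1)) := by
    refine ⟨fun j ↦ j.casesOn 0 p, ?_⟩
    rw [Finset.sum_range_succ']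
    simp
  have h2 : HasOrderLT (d + 1)
      (∑ j ∈ Finset.range d, ofPoly (Polynomial.derivative (p j)) * x k ^ j) :=
    HasOrderLT.mono (by lia) ⟨fun j ↦ Polynomial.derivative (p j), rfl⟩
  convert! h1.add h2 using 1
  rw [Finset.mul_sum, ← Finset.sum_add_distrib]
  refine Finset.sum_congr rfl fun j _ ↦ ?_
  rw [← mul_assoc, x_mul_ofPoly, add_mul, mul_assoc, ← pow_succ']

theorem exists_hasOrderLT (w : FirstWeylAlgebra k) : ∃ d, HasOrderLT d w := by
  induction w using induction_xy with
  | hone => exact ⟨1, fun _ ↦ 1, by simp⟩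
  | hsmul c w hw =>
    obtain ⟨d, hd⟩ := hw
    refine ⟨d, ?_⟩
    rw [Algebra.smul_def, ← AlgHom.commutes ofPoly]
    exact hd.ofPoly_mul _
  | hadd w w' hw hw' =>
    obtain ⟨d, hd⟩ := hw
    obtain ⟨e, he⟩ := hw'
    exact ⟨max d e, (hd.mono (le_max_left _ _)).add (he.mono (le_max_right _ _))⟩
  | hx w hw =>
    obtain ⟨d, hd⟩ := hw
    exact ⟨d + 1, hd.x_mul⟩
  | hy w hw =>
    obtain ⟨d, hd⟩ := hw
    rw [← ofPoly_X]
    exact ⟨d, hd.ofPoly_mul _⟩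

theorem derivX_sum (s : Finset ℕ) (f : ℕ → FirstWeylAlgebra k) :
    derivX (∑ j ∈ s, f j) = ∑ j ∈ s, derivX (f j) := by
  simp only [derivX, Finset.sum_mul, Finset.mul_sum, Finset.sum_sub_distrib]

theorem derivX_sum_range (d : ℕ) (p : ℕ → Polynomial k) :
    derivX (∑ j ∈ Finset.range (d + 1), ofPoly (p j) * x k ^ j) =
      ∑ j ∈ Finset.range d, ofPoly (((j + 1 : ℕ) : Polynomial k) * p (j + 1)) * x k ^ j := by
  rw [derivX_sum, Finset.sum_range_succ', pow_zero, mul_one, derivX_ofPoly, add_zero]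
  simp only [derivX_ofPoly_mul_x_pow]

/-- Applying `derivX` shortens the sum and multiplies the shifted coefficients by nonzero integers,
so induction leaves only `p 0`. -/
theorem ofPoly_sum_eq_zero [CharZero k] {d : ℕ} {p : ℕ → Polynomial k}
    (h : ∑ j ∈ Finset.range d, ofPoly (p j) * x k ^ j = 0) (j : ℕ) (hj : j < d) : p j = 0 := by
  induction d generalizing p j with
  | zero => lia
  | succ d ih =>
    have hpos (i : ℕ) (hi : i < d) : p (i + 1) = 0 := by
      have h' := derivX_sum_range d p
      rw [h, derivX, zero_mul, mul_zero, sub_zero] at h'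
      have := ih h'.symm i hi
      exact (mul_eq_zero.1 this).resolve_left (Nat.cast_ne_zero.2 (by lia))
    cases j with
    | succ j => exact hpos j (by lia)
    | zero =>
      rw [Finset.sum_range_succ', Finset.sum_eq_zero fun i hi ↦ by
        rw [hpos i (Finset.mem_range.1 hi), map_zero, zero_mul]] at h
      exact ofPoly_injective (by simpa using h)

theorem exists_ofPoly_of_derivX_eq_zero [CharZero k] {w : FirstWeylAlgebra k} (hw : derivX w = 0) :
    ∃ p, ofPoly p = w := by
  obtain ⟨d, hd⟩ := exists_hasOrderLT w
  obtain ⟨p, rfl⟩ := hd.mono (Nat.le_succ d)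
  refine ⟨p 0, ?_⟩
  rw [derivX_sum_range] at hw
  rw [Finset.sum_range_succ', Finset.sum_eq_zero fun i hi ↦ by
    rw [(mul_eq_zero.1 (ofPoly_sum_eq_zero hw i (Finset.mem_range.1 hi))).resolve_left
      (Nat.cast_ne_zero.2 (by lia)), map_zero, zero_mul]]
  simp

theorem exists_iterate_derivX_eq_zero (w : FirstWeylAlgebra k) : ∃ d, derivX^[d] w = 0 := by
  obtain ⟨d, hd⟩ := exists_hasOrderLT w
  refine ⟨d, ?_⟩
  induction d generalizing w with
  | zero =>
    obtain ⟨p, rfl⟩ := hd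
    simp
  | succ d ih =>
    obtain ⟨p, rfl⟩ := hd
    rw [Function.iterate_succ_apply, derivX_sum_range]
    exact ih _ ⟨_, rfl⟩

theorem exists_order {w : FirstWeylAlgebra k} (hw : w ≠ 0) :
    ∃ d, derivX^[d] w ≠ 0 ∧ derivX^[d + 1] w = 0 := by
  classical
  have h := exists_iterate_derivX_eq_zero w
  rcases hd : Nat.find h with _ | d
  · exact absurd (by simpa [hd] using Nat.find_spec h) hw
  · exact ⟨d, Nat.find_min h (by lia), by simpa [hd] using Nat.find_spec h⟩

theorem iterate_derivX_add (n : ℕ) (w w' : FirstWeylAlgebra k) :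
    derivX^[n] (w + w') = derivX^[n] w + derivX^[n] w' := by
  induction n generalizing w w' with
  | zero => rfl
  | succ n ih => simp only [Function.iterate_succ_apply, derivX_add, ih]

theorem iterate_derivX_zero (n : ℕ) : derivX^[n] (0 : FirstWeylAlgebra k) = 0 :=
  Function.iterate_fixed (by simp [derivX]) n

/-- The extreme term of the Leibniz rule for `derivX`. -/
theorem exists_iterate_derivX_mul {s d e : ℕ} (hs : d + e = s) {w w' : FirstWeylAlgebra k}
    (hw : derivX^[d + 1] w = 0) (hw' : derivX^[e + 1] w' = 0) :
    ∃ c : ℕ, c ≠ 0 ∧ derivX^[s] (w * w') = c * (derivX^[d] w * derivX^[e] w') := by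
  induction s generalizing d e w w' with
  | zero =>
    obtain ⟨rfl, rfl⟩ : d = 0 ∧ e = 0 := by lia
    exact ⟨1, one_ne_zero, by simp⟩
  | succ s ih =>
    rw [Function.iterate_succ_apply, derivX_mul, iterate_derivX_add]
    rcases d with _ | d
    · obtain rfl : e = s + 1 := by lia
      obtain ⟨c, hc, h⟩ := ih (d := 0) (e := s) (by lia) hw hw'
      refine ⟨c, hc, ?_⟩
      rw [show derivX w = 0 from hw, zero_mul, iterate_derivX_zero, zero_add, h,
        Function.iterate_succ_apply]
    rcases e with _ | e
    · obtain rfl : d = s := by lia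
      obtain ⟨c, hc, h⟩ := ih (d := d) (e := 0) (by lia) hw hw'
      refine ⟨c, hc, ?_⟩
      rw [show derivX w' = 0 from hw', mul_zero, iterate_derivX_zero, add_zero, h,
        Function.iterate_succ_apply]
    -- Pascal's rule: the constant is a binomial coefficient, of which only nonvanishing is
    -- recorded.
    obtain ⟨c, hc, h⟩ := ih (d := d) (e := e + 1) (by lia) hw hw'
    obtain ⟨c', -, h'⟩ := ih (d := d + 1) (e := e) (by lia) hw hw'
    refine ⟨c + c', by lia, ?_⟩
    rw [h, h', Function.iterate_succ_apply, Function.iterate_succ_apply, Nat.cast_add, add_mul]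

/-- The order in `x` is additive under multiplication. -/
theorem iterate_derivX_mul_ne_zero [CharZero k] {d e : ℕ} {w w' : FirstWeylAlgebra k}
    (hw0 : derivX^[d] w ≠ 0) (hw : derivX^[d + 1] w = 0)
    (hw'0 : derivX^[e] w' ≠ 0) (hw' : derivX^[e + 1] w' = 0) : derivX^[d + e] (w * w') ≠ 0 := by
  obtain ⟨c, hc, h⟩ := exists_iterate_derivX_mul rfl hw hw'
  rw [Function.iterate_succ_apply'] at hw hw'
  obtain ⟨p, hp⟩ := exists_ofPoly_of_derivX_eq_zero hw
  obtain ⟨q, hq⟩ := exists_ofPoly_of_derivX_eq_zero hw'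
  rw [← hp] at hw0
  rw [← hq] at hw'0
  rw [h, ← hp, ← hq, ← map_natCast ofPoly, ← map_mul, ← map_mul,
    map_ne_zero_iff _ ofPoly_injective]
  exact mul_ne_zero (Nat.cast_ne_zero.2 hc)
    (mul_ne_zero (fun h ↦ hw0 (by rw [h, map_zero])) fun h ↦ hw'0 (by rw [h, map_zero]))

theorem isDomain [CharZero k] : IsDomain (FirstWeylAlgebra k) := by
  have : Nontrivial (FirstWeylAlgebra k) := ofPoly_injective.nontrivial
  have : NoZeroDivisors (FirstWeylAlgebra k) := ⟨fun {w w'} h ↦ by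
    by_contra! hne
    obtain ⟨d, hd, hd'⟩ := exists_order hne.1
    obtain ⟨e, he, he'⟩ := exists_order hne.2
    exact iterate_derivX_mul_ne_zero hd hd' he he' (by rw [h, iterate_derivX_zero])⟩
  exact NoZeroDivisors.to_isDomain _

/-- The orders in `x` of a unit and its inverse add up to zero, so both lie in `k[y]`, whose units
are scalars. -/
theorem exists_algebraMap_of_isUnit [CharZero k] {w : FirstWeylAlgebra k} (hw : IsUnit w) :
    ∃ c : k, algebraMap k _ c = w := by
  have := isDomain (k := k)
  have key {w w' : FirstWeylAlgebra k} (h : w * w' = 1) : ∃ p, ofPoly p = w := by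
    obtain ⟨d, hd, hd'⟩ := exists_order (left_ne_zero_of_mul_eq_one h)
    obtain ⟨e, he, he'⟩ := exists_order (right_ne_zero_of_mul_eq_one h)
    have hne := iterate_derivX_mul_ne_zero hd hd' he he'
    rcases hs : d + e with _ | s
    · obtain rfl : d = 0 := by lia
      exact exists_ofPoly_of_derivX_eq_zero hd'
    · rw [h, hs, Function.iterate_succ_apply, ← map_one ofPoly, derivX_ofPoly,
        iterate_derivX_zero] at hne
      exact absurd rfl hne
  obtain ⟨w', h, h'⟩ := isUnit_iff_exists.1 hw
  obtain ⟨p, rfl⟩ := key h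
  obtain ⟨q, rfl⟩ := key h'
  rw [← map_mul, ← map_one ofPoly] at h
  obtain ⟨c, -, hc⟩ := Polynomial.isUnit_iff.1 (IsUnit.of_mul_eq_one _ (ofPoly_injective h))
  exact ⟨c, by rw [← hc, ← Polynomial.algebraMap_eq, AlgHom.commutes]⟩

/-- The commutator with `x` differentiates `p(y)`, and in characteristic zero this lowers the degree
by exactly one until a nonzero constant remains. -/
theorem one_mem_of_ofPoly_mem [CharZero k] (I : TwoSidedIdeal (FirstWeylAlgebra k))
    {p : Polynomial k} (hp : p ≠ 0) (hI : ofPoly p ∈ I) : 1 ∈ I := by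
  induction hn : p.natDegree generalizing p with
  | zero =>
    obtain ⟨c, rfl⟩ := Polynomial.natDegree_eq_zero.1 hn
    have hc : c ≠ 0 := by rintro rfl; simp at hp
    have := I.mul_mem_left (ofPoly (Polynomial.C c⁻¹)) _ hI
    rwa [← map_mul, ← Polynomial.C_mul, inv_mul_cancel₀ hc, map_one, map_one] at this
  | succ n ih =>
    have hd : (Polynomial.derivative p).natDegree = n := by
      rw [Polynomial.natDegree_derivative, hn, Nat.add_sub_cancel]
    refine ih (p := Polynomial.derivative p) (fun h ↦ ?_) ?_ hd
    · have := Polynomial.derivative_eq_zero.1 h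
      lia
    · rw [← add_sub_cancel_left (ofPoly p * x k) (ofPoly (Polynomial.derivative p)),
        ← x_mul_ofPoly]
      exact I.sub_mem (I.mul_mem_left _ _ hI) (I.mul_mem_right _ _ hI)

/-- Ideals are stable under `derivX`; its last nonzero iterate on a nonzero element of the ideal
lies in `k[y]`. -/
theorem isSimpleRing [CharZero k] : IsSimpleRing (FirstWeylAlgebra k) := by
  have : Nontrivial (FirstWeylAlgebra k) := ofPoly_injective.nontrivial
  refine ⟨⟨fun I ↦ or_iff_not_imp_left.2 fun hI ↦ ?_⟩⟩
  rw [← TwoSidedIdeal.one_mem_iff]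
  obtain ⟨w, hw, hw0⟩ : ∃ w ∈ I, w ≠ 0 := by
    by_contra! h
    exact hI (eq_bot_iff.2 fun w hw ↦ (TwoSidedIdeal.mem_bot _).2 (h w hw))
  obtain ⟨d, hd, hd'⟩ := exists_order hw0
  rw [Function.iterate_succ_apply'] at hd'
  obtain ⟨p, hp⟩ := exists_ofPoly_of_derivX_eq_zero hd'
  refine one_mem_of_ofPoly_mem I (p := p) (fun h ↦ hd (by rw [← hp, h, map_zero])) ?_
  rw [hp]
  clear hd hd' hp
  induction d with
  | zero => exact hw
  | succ d ih =>
    rw [Function.iterate_succ_apply']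
    exact I.sub_mem (I.mul_mem_right _ _ ih) (I.mul_mem_left _ _ ih)

end FirstWeylAlgebra
end

theorem theorem4p6 (k : Type u) [Field k] :
    (∀ (A : Type v) [Ring A] [Algebra k A] [IsDomain A] [IsSimpleRing A],
      (IsNoetherianRing Aᵐᵒᵖ ∨ IsNoetherianRing A) →
      (∀ a : A, IsUnit a ↔ ∃ c : k, c ≠ 0 ∧ algebraMap k A c = a) →
      StronglySigmaCancellative.{u, v, w} k A) ∧
    (CharZero k → StronglySigmaCancellative.{u, u, w} k (FirstWeylAlgebra k)) := by
  refine ⟨fun A _ _ _ _ _ hA ↦ .of_isSimpleRing k A fun a ha ↦ ?_, fun _ ↦ ?_⟩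
  · obtain ⟨c, -, hc⟩ := (hA a).1 ha
    exact ⟨c, hc⟩
  · have := FirstWeylAlgebra.isDomain (k := k)
    have := FirstWeylAlgebra.isSimpleRing (k := k)
    exact .of_isSimpleRing k _ fun _ ↦ FirstWeylAlgebra.exists_algebraMap_of_isUnit
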